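/- Let $\Gamma_1$ be the graph obtained from an equilateral triangle by joining the midpoints of its sides: its vertices are the three corners and the three midpoints, and it has nine edges. Label the six boundary edges $a,b,a,b,a,b$ in counterclockwise cyclic order, starting with the label $a$ on the edge that goes down from the top corner to the midpoint of the left side, and label the three edges joining midpoints by $c$. For $n\ge 1$, partition an equilateral triangle into four smaller equilateral triangles and place a translated copy of the labelled graph $\Gamma_n$ in each of the three corner triangles, identifying coinciding corners; the resulting labelled graph is $\Gamma_{n+1}$ (the Sierpiński graphs with the rotation-invariant labelling). The corners of the big triangle are called the outmost vertices of $\Gamma_n$. Give each edge the weight named by its label, where $a,b,c$ are formal variables (or arbitrary elements of a commutative semiring), and let the weight of a subgraph be the product of the weights of its edges. A spanning $k$-forest of $\Gamma_n$ is an acyclic subgraph with exactly $k$ connected components that contains all vertices of $\Gamma_n$. For $n\geq 1$ let - $T_n=T_n(a,b,c)$ be the sum of the weights of all spanning trees of $\Gamma_n$; - $S_n=S_n(a,b,c)$ be the sum of the weights of all spanning $2$-forests of $\Gamma_n$ in which two fixed outmost vertices lie in the same component and the third outmost vertex lies in the other component; - $Q_n=Q_n(a,b,c)$ be the sum of the weights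 of all spanning $3$-forests of $\Gamma_n$ in which the three outmost vertices lie in three different components. Then $S_n$ does not depend on the choice of the two outmost vertices, and for every $n\ge 1$ $$T_{n+1}=6T_n^2S_n,\qquad S_{n+1}=7T_nS_n^2+T_n^2Q_n,\qquad Q_{n+1}=12T_nS_nQ_n+14S_n^3,$$ with initial conditions $$T_1=3(a+b)(ab+ac+bc)^2,\qquad S_1=(a+b)(a+b+3c)(ab+ac+bc),\qquad Q_1=(a+b)(a+b+3c)^2.$$ -/

import Mathlib

namespace SierpinskiTrees

/-- The three edge labels. -/
inductive Label
  | a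
  | b
  | c

/-- Translation of a lattice point. The pair `(i, j)` stands for the point
`i • (1, 0) + j • (1/2, √3/2)` of the triangular lattice, so that `(0, 0)` is the left corner,
`(2 ^ n, 0)` the right corner and `(0, 2 ^ n)` the top corner of a triangle of side `2 ^ n`. -/
def shift (d p : ℕ × ℕ) : ℕ × ℕ := (d.1 + p.1, d.2 + p.2)

/-- The vertices of the `n`-th Sierpiński graph: three translated copies of the preceding vertex
set, placed in the corners of a triangle of twice the side. Level `0` is a single triangle;
level `1` consists of the three corners and the three midpoints of the sides. -/
def vertices : ℕ → Finset (ℕ × ℕ)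
  | 0 => {(0, 0), (1, 0), (0, 1)}
  | n + 1 => vertices n ∪ (vertices n).image (shift (2 ^ n, 0)) ∪
      (vertices n).image (shift (0, 2 ^ n))

/-- The edges of the first graph carrying a given label: along the boundary the labels
`a, b, a, b, a, b` alternate, and the three edges joining midpoints of sides carry `c`. -/
def baseEdges : Label → Finset (Sym2 (ℕ × ℕ))
  | .a => {s((0, 2), (0, 1)), s((0, 0), (1, 0)), s((2, 0), (1, 1))}
  | .b => {s((0, 1), (0, 0)), s((1, 0), (2, 0)), s((1, 1), (0, 2))}
  | .c => {s((0, 1), (1, 0)), s((1, 0), (1, 1)), s((1, 1), (0, 1))}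

/-- The edges of the `n`-th Sierpiński graph carrying the label `x` in the rotation-invariant
labelling, for `n ≥ 1`: three translated copies of the preceding labelled graph. The labelling
starts at level `1`; nothing is labelled at level `0`. -/
def edges (x : Label) : ℕ → Finset (Sym2 (ℕ × ℕ))
  | 0 => ∅
  | 1 => baseEdges x
  | n + 2 => edges x (n + 1) ∪ (edges x (n + 1)).image (Sym2.map (shift (2 ^ (n + 1), 0))) ∪
      (edges x (n + 1)).image (Sym2.map (shift (0, 2 ^ (n + 1))))

/-- The vertex type of the `n`-th Sierpiński graph. -/
abbrev Vert (n : ℕ) : Type := {p : ℕ × ℕ // p ∈ vertices n}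

/-- The `n`-th Sierpiński graph (`n ≥ 1`). -/
def graph (n : ℕ) : SimpleGraph (Vert n) :=
  SimpleGraph.fromEdgeSet {e | ∃ x : Label, e.map Subtype.val ∈ edges x n}

/-- The weight of an edge: the value given to its label. -/
def edgeWeight {R : Type*} (a b c : R) (n : ℕ) (e : Sym2 (Vert n)) : R :=
  if e.map Subtype.val ∈ edges .a n then a
  else if e.map Subtype.val ∈ edges .b n then b
  else c

/-- The coordinates of the three outmost vertices. -/
def cornerPoint (n : ℕ) : Fin 3 → ℕ × ℕ
  | 0 => (0, 0)
  | 1 => (2 ^ n, 0)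
  | 2 => (0, 2 ^ n)

theorem cornerPoint_mem (n : ℕ) (i : Fin 3) : cornerPoint n i ∈ vertices n := by
  induction n with
  | zero => fin_cases i <;> decide
  | succ n ih =>
    simp only [vertices, Finset.mem_union, Finset.mem_image]
    fin_cases i
    · exact Or.inl (Or.inl ih)
    · exact Or.inl (Or.inr ⟨_, ih, by simp [cornerPoint, shift, pow_succ, mul_two]⟩)
    · exact Or.inr ⟨_, ih, by simp [cornerPoint, shift, pow_succ, mul_two]⟩

/-- The three outmost vertices of the `n`-th graph. -/
def corner (n : ℕ) (i : Fin 3) : Vert n := ⟨cornerPoint n i, cornerPoint_mem n i⟩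

/-- A graph on `V` which is a forest with exactly `k` connected components. -/
def IsForestWith {V : Type*} (k : ℕ) (H : SimpleGraph V) : Prop :=
  H.IsAcyclic ∧ Nat.card H.ConnectedComponent = k

open Classical in
/-- The weighted generating function of the spanning subgraphs of `G` having the property `P`.
A spanning subgraph is a graph `H ≤ G` on the same vertex type; its weight is the product of the
weights of its edges. -/
noncomputable def genFun {V R : Type*} [Fintype V] [CommSemiring R] (G : SimpleGraph V)
    (w : Sym2 V → R) (P : SimpleGraph V → Prop) : R :=
  ∑ H : SimpleGraph V with H ≤ G ∧ P H, ∏ e ∈ H.edgeFinset, w e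

/-- Weighted generating function of the spanning trees of the `n`-th graph. -/
noncomputable def T {R : Type*} [CommSemiring R] (a b c : R) (n : ℕ) : R :=
  genFun (graph n) (edgeWeight a b c n) fun H => H.IsTree

/-- Weighted generating function of the spanning `2`-forests of the `n`-th graph in which the two
outmost vertices other than `corner n i` lie in the same component and `corner n i` lies in the
other one. -/
noncomputable def S {R : Type*} [CommSemiring R] (a b c : R) (i : Fin 3) (n : ℕ) : R :=
  genFun (graph n) (edgeWeight a b c n) fun H => IsForestWith 2 H ∧
    H.Reachable (corner n (i + 1)) (corner n (i + 2)) ∧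
    ¬ H.Reachable (corner n i) (corner n (i + 1))

/-- Weighted generating function of the spanning `3`-forests of the `n`-th graph in which the three
outmost vertices lie in three different components. -/
noncomputable def Q {R : Type*} [CommSemiring R] (a b c : R) (n : ℕ) : R :=
  genFun (graph n) (edgeWeight a b c n) fun H => IsForestWith 3 H ∧
    ∀ i j : Fin 3, i ≠ j → ¬ H.Reachable (corner n i) (corner n j)

end SierpinskiTrees

/-!
Let graphs be glued along terminal vertices, and let spanning forests of the pieces be given, each
of whose components contains a terminal. The partition of all terminals by the components of the
union is generated by the identifications and by the partitions coming from the forests. Since a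
finite graph is acyclic if and only if its numbers of edges and of components add up to its number
of vertices, acyclicity of the union becomes a count of blocks of these partitions. So a generating
function of forests of the glued graph is a sum, over a finite set of combinations of partitions, of
products of generating functions of the pieces.

`Γ₁` is itself a gluing of three triangles, arranged like the three copies of `Γₙ` in `Γₙ₊₁`, so a
single enumeration of these combinations yields both the initial values and the recursion.
-/

namespace SierpinskiTrees

open SimpleGraph

section Glue

variable {κ W : Type*} {V : κ → Type*} (f : ∀ k, V k ↪ W)

/-- The graph obtained by drawing the pieces `H k` on the images of the embeddings `f k`. -/
def glue (H : ∀ k, SimpleGraph (V k)) : SimpleGraph W :=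
  ⨆ k, (H k).map (f k)

variable {f} {H : ∀ k, SimpleGraph (V k)}

theorem glue_adj {u v : W} :
    (glue f H).Adj u v ↔ ∃ k a b, (H k).Adj a b ∧ f k a = u ∧ f k b = v := by
  simp [glue, SimpleGraph.map_adj]

theorem reachable_glue {k : κ} {v w : V k} (h : (H k).Reachable v w) :
    (glue f H).Reachable (f k v) (f k w) :=
  h.map ⟨f k, fun hab => glue_adj.2 ⟨k, _, _, hab, rfl, rfl⟩⟩

theorem glue_mono {G : ∀ k, SimpleGraph (V k)} (h : ∀ k, H k ≤ G k) : glue f H ≤ glue f G :=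
  iSup_mono fun k => map_monotone (f k) (h k)

theorem glue_comap {G : ∀ k, SimpleGraph (V k)} {K : SimpleGraph W} (hK : K ≤ glue f G) :
    glue f (fun k => K.comap (f k)) = K := by
  refine le_antisymm (iSup_le fun k => map_comap_le _ _) fun u v h => ?_
  obtain ⟨k, a, b, -, rfl, rfl⟩ := glue_adj.1 (hK h)
  exact glue_adj.2 ⟨k, a, b, h, rfl, rfl⟩

/-- The images of the embeddings pairwise share at most one vertex, so that no edge can be drawn
on two of them. -/
def EdgeDisjoint (f : ∀ k, V k ↪ W) : Prop :=
  Pairwise fun k l => (Set.range (f k) ∩ Set.range (f l)).Subsingleton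

theorem EdgeDisjoint.comap_glue (hf : EdgeDisjoint f) (l : κ) : (glue f H).comap (f l) = H l := by
  ext a b
  rw [comap_adj, glue_adj]
  refine ⟨fun ⟨k, c, d, hcd, hc, hd⟩ => ?_, fun h => ⟨l, a, b, h, rfl, rfl⟩⟩
  obtain rfl | hkl := eq_or_ne k l
  · rwa [← (f k).injective hc, ← (f k).injective hd]
  · have h := hf hkl ⟨⟨c, rfl⟩, a, hc.symm⟩ ⟨⟨d, rfl⟩, b, hd.symm⟩
    exact absurd ((f k).injective h) hcd.ne

theorem edgeSet_glue : (glue f H).edgeSet = ⋃ k, (f k).sym2Map '' (H k).edgeSet := by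
  simp only [glue, edgeSet_iSup, edgeSet_map]

theorem EdgeDisjoint.disjoint_image_edgeSet (hf : EdgeDisjoint f) {k l : κ} (hkl : k ≠ l) :
    Disjoint ((f k).sym2Map '' (H k).edgeSet) ((f l).sym2Map '' (H l).edgeSet) := by
  refine Set.disjoint_left.2 ?_
  rintro _ ⟨⟨a, b⟩, hab, rfl⟩ ⟨⟨c, d⟩, -, h⟩
  have hmem : ∀ v ∈ s(f k a, f k b), v ∈ Set.range (f l) := by
    change s(f l c, f l d) = s(f k a, f k b) at h
    simp [← h]
  exact Adj.ne hab <| (f k).injective <|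
    hf hkl ⟨⟨a, rfl⟩, hmem _ (Sym2.mem_mk_left _ _)⟩ ⟨⟨b, rfl⟩, hmem _ (Sym2.mem_mk_right _ _)⟩

open Classical in
@[to_additive]
theorem EdgeDisjoint.prod_edgeFinset_glue [Fintype κ] [∀ k, Fintype (V k)] [Fintype W]
    {M : Type*} [CommMonoid M] (hf : EdgeDisjoint f) (w : Sym2 W → M) :
    ∏ e ∈ (glue f H).edgeFinset, w e = ∏ k, ∏ e ∈ (H k).edgeFinset, w (e.map (f k)) := by
  have hunion : (glue f H).edgeFinset =
      Finset.univ.biUnion fun k => (H k).edgeFinset.map (f k).sym2Map := by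
    ext e
    simp [edgeSet_glue]
  rw [hunion, Finset.prod_biUnion]
  · simp only [Finset.prod_map, Function.Embedding.sym2Map_apply]
  · intro k _ l _ hkl
    simpa [Function.onFun, ← Finset.disjoint_coe] using hf.disjoint_image_edgeSet (H := H) hkl

theorem EdgeDisjoint.card_edgeSet_glue [Fintype κ] [∀ k, Finite (V k)] [Finite W]
    (hf : EdgeDisjoint f) : Nat.card (glue f H).edgeSet = ∑ k, Nat.card (H k).edgeSet := by
  classical
  have := Fintype.ofFinite W
  have (k : κ) := Fintype.ofFinite (V k)
  simp only [Nat.card_eq_fintype_card, ← edgeFinset_card, Finset.card_eq_sum_ones,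
    hf.sum_edgeFinset_glue]

end Glue

section ForestCount

variable {V : Type*}

theorem edgeDisjoint_subtype_supp (H : SimpleGraph V) :
    EdgeDisjoint fun c : H.ConnectedComponent => Function.Embedding.subtype (· ∈ c.supp) := by
  rintro c d hcd _ ⟨⟨⟨u, hu⟩, rfl⟩, ⟨⟨_, hv⟩, rfl⟩⟩
  exact absurd (hu.symm.trans hv) hcd

theorem glue_toSimpleGraph (H : SimpleGraph V) :
    glue (fun c : H.ConnectedComponent => Function.Embedding.subtype (· ∈ c.supp))
      (fun c => c.toSimpleGraph) = H := by
  refine glue_comap (G := fun _ => ⊤) fun u v h => glue_adj.2 ?_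
  exact ⟨H.connectedComponentMk u, ⟨u, rfl⟩, ⟨v, (ConnectedComponent.sound h.reachable).symm⟩,
    fun huv => h.ne (congrArg Subtype.val huv), rfl, rfl⟩

variable [Finite V] {H : SimpleGraph V}

theorem card_edgeSet_add_card_connectedComponent (hH : H.IsAcyclic) :
    Nat.card H.edgeSet + Nat.card H.ConnectedComponent = Nat.card V := by
  have := Fintype.ofFinite H.ConnectedComponent
  have hcomp (c : H.ConnectedComponent) :
      Nat.card c.toSimpleGraph.edgeSet + 1 = Nat.card c.supp :=
    (isTree_iff_connected_and_card.1 (hH.isTree_connectedComponent c)).2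
  have hV : Nat.card V = ∑ c : H.ConnectedComponent, Nat.card c.supp := by
    rw [Nat.card_congr (Equiv.sigmaFiberEquiv H.connectedComponentMk).symm, Nat.card_sigma]
    rfl
  have hE := (edgeDisjoint_subtype_supp H).card_edgeSet_glue (H := fun c => c.toSimpleGraph)
  rw [glue_toSimpleGraph] at hE
  rw [hE, hV, ← Finset.sum_congr rfl fun c _ => hcomp c, Finset.sum_add_distrib,
    Finset.sum_const, Finset.card_univ, smul_eq_mul, mul_one,
    Nat.card_eq_fintype_card (α := H.ConnectedComponent)]
  rfl

theorem isAcyclic_iff_card_edgeSet_add_card_connectedComponent :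
    H.IsAcyclic ↔ Nat.card H.edgeSet + Nat.card H.ConnectedComponent = Nat.card V := by
  refine ⟨card_edgeSet_add_card_connectedComponent, fun h => ?_⟩
  obtain ⟨F, hFH, hF, hreach⟩ := H.exists_isAcyclic_reachable_eq_le
  have hcomp : Nat.card F.ConnectedComponent = Nat.card H.ConnectedComponent :=
    Nat.card_congr (Quot.congrRight fun u v => by rw [hreach])
  have hedges : Nat.card F.edgeSet = Nat.card H.edgeSet := by
    have := card_edgeSet_add_card_connectedComponent hF
    omega
  suffices F = H from this ▸ hF
  exact edgeSet_injective <|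
    Set.eq_of_subset_of_ncard_le (edgeSet_mono hFH) hedges.ge (Set.toFinite _)

end ForestCount

section Terminals

variable {ι V : Type*}

theorem reachableSetoid_le_iff {H : SimpleGraph V} {r : Setoid V} :
    H.reachableSetoid ≤ r ↔ ∀ u v, H.Adj u v → r u v := by
  refine ⟨fun h u v huv => h huv.reachable, ?_⟩
  rintro h u v ⟨p⟩
  induction p with
  | nil => exact r.refl _
  | cons huv _ ih => exact r.trans (h _ _ huv) ih

/-- The partition of the terminals `p i` according to the components of `H`. -/
def terminalSetoid (p : ι → V) (H : SimpleGraph V) : Setoid ι :=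
  H.reachableSetoid.comap p

/-- Every component of `H` contains a terminal. -/
def Covers (p : ι → V) (H : SimpleGraph V) : Prop :=
  ∀ v, ∃ i, H.Reachable v (p i)

/-- `H` is a forest, each of its components contains a terminal, and the components partition the
terminals according to `s`. -/
structure IsTerminalForest (p : ι → V) (s : Setoid ι) (H : SimpleGraph V) : Prop where
  isAcyclic : H.IsAcyclic
  covers : Covers p H
  terminalSetoid_eq : terminalSetoid p H = s

variable {p : ι → V} {s : Setoid ι} {H : SimpleGraph V}

theorem isTerminalForest_top_iff [Nonempty ι] :
    IsTerminalForest p ⊤ H ↔ H.IsTree := by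
  constructor
  · rintro ⟨hacyclic, hcov, hterminal⟩
    have hp (i j : ι) : H.Reachable (p i) (p j) := Setoid.eq_top_iff.1 hterminal i j
    have : Nonempty V := ‹Nonempty ι›.map p
    refine ⟨⟨fun u v => ?_⟩, hacyclic⟩
    obtain ⟨i, hi⟩ := hcov u
    obtain ⟨j, hj⟩ := hcov v
    exact hi.trans ((hp i j).trans hj.symm)
  · intro h
    exact ⟨h.isAcyclic, fun v => ⟨Classical.arbitrary ι, h.connected v _⟩,
      Setoid.eq_top_iff.2 fun i j => h.connected (p i) (p j)⟩

theorem surjective_connectedComponentMk_comp_iff :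
    Function.Surjective (H.connectedComponentMk ∘ p) ↔ Covers p H := by
  simp only [Function.Surjective, ConnectedComponent.forall, Function.comp, ConnectedComponent.eq,
    Covers, reachable_comm]

theorem card_quotient_terminalSetoid :
    Nat.card (Quotient (terminalSetoid p H)) =
      (Set.range (H.connectedComponentMk ∘ p)).ncard :=
  Nat.card_congr (Setoid.comapQuotientEquiv p H.reachableSetoid)

theorem Covers.card_connectedComponent (hH : Covers p H) :
    Nat.card H.ConnectedComponent = Nat.card (Quotient (terminalSetoid p H)) := by
  rw [card_quotient_terminalSetoid, (surjective_connectedComponentMk_comp_iff.2 hH).range_eq,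
    Set.ncard_univ]

variable [Finite V]

theorem covers_iff_card_connectedComponent :
    Covers p H ↔ Nat.card H.ConnectedComponent = Nat.card (Quotient (terminalSetoid p H)) := by
  refine ⟨Covers.card_connectedComponent, fun h => ?_⟩
  rw [card_quotient_terminalSetoid, eq_comm, ← Set.eq_univ_iff_ncard] at h
  exact surjective_connectedComponentMk_comp_iff.1 (Set.range_eq_univ.1 h)

theorem isTerminalForest_iff : IsTerminalForest p s H ↔
    IsForestWith (Nat.card (Quotient s)) H ∧ terminalSetoid p H = s := by
  constructor
  · rintro ⟨hH, hc, rfl⟩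
    exact ⟨⟨hH, hc.card_connectedComponent⟩, rfl⟩
  · rintro ⟨⟨hH, hc⟩, rfl⟩
    exact ⟨hH, covers_iff_card_connectedComponent.2 hc, rfl⟩

theorem Covers.isAcyclic_iff (hH : Covers p H) : H.IsAcyclic ↔
    Nat.card H.edgeSet + Nat.card (Quotient (terminalSetoid p H)) = Nat.card V := by
  rw [isAcyclic_iff_card_edgeSet_add_card_connectedComponent, hH.card_connectedComponent]

theorem IsTerminalForest.card_edgeSet_add (hH : IsTerminalForest p s H) :
    Nat.card H.edgeSet + Nat.card (Quotient s) = Nat.card V := by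
  obtain ⟨hacyclic, hcov, rfl⟩ := hH
  exact hcov.isAcyclic_iff.1 hacyclic

end Terminals

section Gluing

variable {κ ι ι' W : Type*} {V : κ → Type*}

/-- The embeddings `f k` cover `W`, no edge fits into two of the pieces, and vertices lying in two
pieces are terminals. -/
structure IsGluing (p : ∀ k, ι → V k) (f : ∀ k, V k ↪ W) : Prop where
  surjective : ∀ w, ∃ k v, f k v = w
  edgeDisjoint : EdgeDisjoint f
  exists_eq_terminal : ∀ {k l}, k ≠ l → ∀ {v w}, f k v = f l w → ∃ i, v = p k i

/-- The terminals of all pieces, as vertices of the glued graph. -/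
def node (p : ∀ k, ι → V k) (f : ∀ k, V k ↪ W) (u : κ × ι) : W :=
  f u.1 (p u.1 u.2)

/-- The partition generated by identifying the terminals of the pieces along `e` and connecting
the terminals of the piece `k` along `x k`. -/
def gluedSetoid (e : Setoid (κ × ι)) (x : κ → Setoid ι) : Setoid (κ × ι) :=
  sInf {r | e ≤ r ∧ ∀ k, x k ≤ r.comap (Prod.mk k)}

theorem gluedSetoid_le_iff {e : Setoid (κ × ι)} {x : κ → Setoid ι} {r : Setoid (κ × ι)} :
    gluedSetoid e x ≤ r ↔ e ≤ r ∧ ∀ k, x k ≤ r.comap (Prod.mk k) := by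
  refine ⟨fun h => ⟨fun u v huv => h fun s hs => hs.1 huv, fun k i j hij => h fun s hs => ?_⟩,
    fun h => sInf_le h⟩
  exact hs.2 k hij

namespace IsGluing

variable {p : ∀ k, ι → V k} {f : ∀ k, V k ↪ W} (hf : IsGluing p f) {H : ∀ k, SimpleGraph (V k)}
include hf

theorem exists_eq_terminal_of_eq_node {k : κ} {v : V k} {u : κ × ι} (h : f k v = node p f u) :
    ∃ i, v = p k i := by
  obtain ⟨l, j⟩ := u
  obtain rfl | hkl := eq_or_ne k l
  · exact ⟨j, (f k).injective h⟩
  · exact hf.exists_eq_terminal hkl h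

theorem gluedSetoid_of_reachable {k l : κ} {v : V k} {w : V l} {i j : ι} (h : f k v = f l w)
    (hv : (H k).Reachable v (p k i)) (hw : (H l).Reachable w (p l j)) :
    gluedSetoid (Setoid.ker (node p f)) (fun k => terminalSetoid (p k) (H k)) (k, i) (l, j) := by
  set g := gluedSetoid (Setoid.ker (node p f)) (fun k => terminalSetoid (p k) (H k))
  obtain ⟨hker, hpiece⟩ := gluedSetoid_le_iff.1 (le_refl g)
  obtain rfl | hkl := eq_or_ne k l
  · obtain rfl := (f k).injective h
    exact hpiece k (hv.symm.trans hw)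
  · obtain ⟨i', rfl⟩ := hf.exists_eq_terminal hkl h
    obtain ⟨j', rfl⟩ := hf.exists_eq_terminal hkl.symm h.symm
    exact g.trans (hpiece k hv.symm) (g.trans (hker h) (hpiece l hw))

theorem terminalSetoid_glue (hH : ∀ k, Covers (p k) (H k)) :
    terminalSetoid (node p f) (glue f H) =
      gluedSetoid (Setoid.ker (node p f)) (fun k => terminalSetoid (p k) (H k)) := by
  refine le_antisymm (fun u v huv => ?_)
    (gluedSetoid_le_iff.2 ⟨fun u v huv => ?_, fun k i j hij => reachable_glue hij⟩)
  · choose piece vertex hpiece using hf.surjective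
    choose terminal hterminal using hH
    -- Colour a vertex by a terminal reached from it inside one of its pieces: the ends of every
    -- edge then have equivalent colours, and so do all vertices of a component.
    let colour (w : W) := (piece w, terminal (piece w) (vertex w))
    set g := gluedSetoid (Setoid.ker (node p f)) (fun k => terminalSetoid (p k) (H k))
    have hcolour {k : κ} {v : V k} {i : ι} (h : (H k).Reachable v (p k i)) :
        g (colour (f k v)) (k, i) :=
      hf.gluedSetoid_of_reachable (hpiece _) (hterminal _ _) h
    have hconst : (glue f H).reachableSetoid ≤ g.comap colour := by
      refine reachableSetoid_le_iff.2 fun w w' hww' => ?_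
      obtain ⟨k, a, b, hab, rfl, rfl⟩ := glue_adj.1 hww'
      have hb := hterminal k b
      exact g.trans (hcolour (hab.reachable.trans hb)) (g.symm (hcolour hb))
    exact g.trans (g.symm (hcolour (Reachable.refl _)))
      (g.trans (hconst huv) (hcolour (Reachable.refl _)))
  · change (glue f H).Reachable (node p f u) (node p f v)
    rw [Setoid.ker_def.1 huv]

theorem covers_of_covers_glue {out : ι' → κ × ι} (h : Covers (node p f ∘ out) (glue f H)) (k : κ) :
    Covers (p k) (H k) := by
  intro v
  by_contra! hv
  -- The component of `v` in its piece would avoid all terminals, so no edge of the glued graph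
  -- could leave it.
  have hstep {a b : W} (hab : (glue f H).Adj a b) :
      (∃ u, (H k).Reachable v u ∧ f k u = a) → ∃ u, (H k).Reachable v u ∧ f k u = b := by
    rintro ⟨u, hu, rfl⟩
    obtain ⟨l, c, d, hcd, hc, rfl⟩ := glue_adj.1 hab
    obtain rfl | hkl := eq_or_ne k l
    · obtain rfl := (f k).injective hc
      exact ⟨d, hu.trans hcd.reachable, rfl⟩
    · obtain ⟨i, rfl⟩ := hf.exists_eq_terminal hkl hc.symm
      exact absurd hu (hv i)
  have hclosed : (glue f H).reachableSetoid ≤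
      Setoid.ker fun a => ∃ u, (H k).Reachable v u ∧ f k u = a :=
    reachableSetoid_le_iff.2 fun a b hab => propext ⟨hstep hab, hstep hab.symm⟩
  obtain ⟨i, hi⟩ := h (f k v)
  obtain ⟨u, hu, huv⟩ := (iff_of_eq (hclosed hi)).1 ⟨v, Reachable.refl _, rfl⟩
  obtain ⟨j, rfl⟩ := hf.exists_eq_terminal_of_eq_node huv
  exact hv j hu

theorem covers_glue_iff {out : ι' → κ × ι} : Covers (node p f ∘ out) (glue f H) ↔
    (∀ k, Covers (p k) (H k)) ∧
      ∀ u, ∃ i, terminalSetoid (node p f) (glue f H) u (out i) := by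
  refine ⟨fun h => ⟨hf.covers_of_covers_glue h, fun u => h (node p f u)⟩, fun ⟨hH, h⟩ w => ?_⟩
  obtain ⟨k, v, rfl⟩ := hf.surjective w
  obtain ⟨i, hi⟩ := hH k v
  obtain ⟨j, hj⟩ := h (k, i)
  exact ⟨j, (reachable_glue hi).trans hj⟩

theorem isAcyclic_of_isAcyclic_glue (h : (glue f H).IsAcyclic) (k : κ) : (H k).IsAcyclic := by
  rw [← hf.edgeDisjoint.comap_glue (H := H) k]
  exact h.comap (Embedding.comap (f k) _).toHom (f k).injective

variable [Fintype κ] [∀ k, Finite (V k)] [Finite W]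

theorem card_edgeSet_glue_add {x : κ → Setoid ι} (hx : ∀ k, IsTerminalForest (p k) (x k) (H k)) :
    Nat.card (glue f H).edgeSet + ∑ k, Nat.card (Quotient (x k)) = ∑ k, Nat.card (V k) := by
  rw [hf.edgeDisjoint.card_edgeSet_glue, ← Finset.sum_add_distrib]
  exact Finset.sum_congr rfl fun k _ => (hx k).card_edgeSet_add

theorem isTerminalForest_glue_iff {out : ι' → κ × ι} {y : Setoid ι'} :
    IsTerminalForest (node p f ∘ out) y (glue f H) ↔ ∃ x : κ → Setoid ι,
      (∀ k, IsTerminalForest (p k) (x k) (H k)) ∧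
      (∀ u, ∃ i, gluedSetoid (Setoid.ker (node p f)) x u (out i)) ∧
      (gluedSetoid (Setoid.ker (node p f)) x).comap out = y ∧
      ∑ k, Nat.card (Quotient (x k)) + Nat.card W =
        Nat.card (Quotient y) + ∑ k, Nat.card (V k) := by
  constructor
  · intro hglue
    obtain ⟨hH, hout⟩ := hf.covers_glue_iff.1 hglue.covers
    have hx k : IsTerminalForest (p k) (terminalSetoid (p k) (H k)) (H k) :=
      ⟨hf.isAcyclic_of_isAcyclic_glue hglue.isAcyclic k, hH k, rfl⟩
    have hpieces := hf.card_edgeSet_glue_add hx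
    have hwhole := hglue.card_edgeSet_add
    rw [hf.terminalSetoid_glue hH] at hout
    exact ⟨_, hx, hout, hf.terminalSetoid_glue hH ▸ hglue.terminalSetoid_eq, by omega⟩
  · rintro ⟨x, hx, hout, hy, hcard⟩
    have hterminal : x = fun k => terminalSetoid (p k) (H k) :=
      funext fun k => (hx k).terminalSetoid_eq.symm
    have hH k := (hx k).covers
    rw [hterminal, ← hf.terminalSetoid_glue hH] at hout hy
    have hcov := hf.covers_glue_iff.2 ⟨hH, hout⟩
    have hpieces := hf.card_edgeSet_glue_add hx
    have hy : terminalSetoid (node p f ∘ out) (glue f H) = y := hy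
    exact ⟨hcov.isAcyclic_iff.2 (by rw [hy]; omega), hcov, hy⟩

end IsGluing

end Gluing

section GenFun

variable {R : Type*} [CommSemiring R]

section Basic

variable {V : Type*} [Fintype V] {G : SimpleGraph V} {w : Sym2 V → R}

theorem genFun_congr {w' : Sym2 V → R} {P P' : SimpleGraph V → Prop}
    (hw : ∀ e ∈ G.edgeSet, w e = w' e) (hP : ∀ H ≤ G, P H ↔ P' H) :
    genFun G w P = genFun G w' P' := by
  classical
  refine Finset.sum_congr (Finset.filter_congr fun H _ => and_congr_right (hP H)) fun H hH => ?_
  exact Finset.prod_congr rfl fun e he =>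
    hw e (edgeSet_mono (Finset.mem_filter.1 hH).2.1 (mem_edgeFinset.1 he))

theorem genFun_exists_mem {X : Type*} {P : X → SimpleGraph V → Prop} (A : Finset X)
    (hP : ∀ H x y, P x H → P y H → x = y) :
    genFun G w (fun H => ∃ x ∈ A, P x H) = ∑ x ∈ A, genFun G w (P x) := by
  classical
  simp only [genFun]
  rw [← Finset.sum_biUnion]
  · refine Finset.sum_congr (Finset.ext fun H => ?_) fun _ _ => rfl
    simp only [Finset.mem_filter, Finset.mem_univ, true_and, Finset.mem_biUnion]
    tauto
  · intro x _ y _ hxy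
    refine Finset.disjoint_filter.2 fun H _ hx hy => hxy (hP H x y hx.2 hy.2)

end Basic

open Classical in
theorem EdgeDisjoint.genFun_glue {κ W : Type*} {V : κ → Type*} [Fintype κ] [∀ k, Fintype (V k)]
    [Fintype W] {f : ∀ k, V k ↪ W} (hf : EdgeDisjoint f) {G : ∀ k, SimpleGraph (V k)}
    (w : Sym2 W → R) (P : ∀ k, SimpleGraph (V k) → Prop) :
    genFun (glue f G) w (fun H => ∀ k, P k (H.comap (f k))) =
      ∏ k, genFun (G k) (fun e => w (e.map (f k))) (P k) := by
  simp only [genFun, Finset.prod_univ_sum]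
  refine Eq.symm (Finset.sum_bij' (fun H _ => glue f H) (fun K _ k => K.comap (f k)) ?_ ?_ ?_ ?_ ?_)
  · intro H hH
    simp only [Fintype.mem_piFinset, Finset.mem_filter, Finset.mem_univ, true_and] at hH ⊢
    refine ⟨glue_mono fun k => (hH k).1, fun k => ?_⟩
    rw [hf.comap_glue]
    exact (hH k).2
  · intro K hK
    simp only [Fintype.mem_piFinset, Finset.mem_filter, Finset.mem_univ, true_and] at hK ⊢
    refine fun k => ⟨?_, hK.2 k⟩
    rw [← hf.comap_glue (H := G) k]
    exact comap_monotone _ hK.1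
  · exact fun H _ => funext hf.comap_glue
  · exact fun K hK => glue_comap (Finset.mem_filter.1 hK).2.1
  · exact fun H _ => (hf.prod_edgeFinset_glue w).symm

section EnumeratedEdges

variable {V α : Type*} {G : SimpleGraph V} {o : α → Sym2 V}

/-- The graph whose edges are the values on `E` of an enumeration `o` of edges. -/
def graphOfEdges (o : α → Sym2 V) (E : Finset α) : SimpleGraph V :=
  fromEdgeSet (o '' (E : Set α))

theorem edgeSet_graphOfEdges (hG : G.edgeSet = Set.range o) (E : Finset α) :
    (graphOfEdges o E).edgeSet = o '' (E : Set α) := by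
  refine (edgeSet_fromEdgeSet _).trans (sdiff_eq_left.2 (Set.disjoint_left.2 ?_))
  rintro _ ⟨m, -, rfl⟩
  exact G.not_isDiag_of_mem_edgeSet (hG ▸ Set.mem_range_self m)

open Classical in
theorem graphOfEdges_filter_mem_edgeSet [Fintype α] (hG : G.edgeSet = Set.range o)
    {H : SimpleGraph V} (hH : H ≤ G) :
    graphOfEdges o (Finset.univ.filter fun m => o m ∈ H.edgeSet) = H := by
  refine edgeSet_injective ((edgeSet_graphOfEdges hG _).trans ?_)
  rw [Finset.coe_filter_univ]
  exact Set.image_preimage_eq_of_subset (hG ▸ edgeSet_mono hH)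

theorem genFun_eq_sum_graphOfEdges [Fintype V] [Fintype α] {w : Sym2 V → R}
    (ho : Function.Injective o) (hG : G.edgeSet = Set.range o) (P : SimpleGraph V → Prop)
    [DecidablePred fun E => P (graphOfEdges o E)] :
    genFun G w P = ∑ E with P (graphOfEdges o E), ∏ m ∈ E, w (o m) := by
  classical
  refine Finset.sum_bij' (fun H _ => Finset.univ.filter fun m => o m ∈ H.edgeSet)
    (fun E _ => graphOfEdges o E) ?_ ?_ ?_ ?_ ?_
  · intro H hH
    simp only [Finset.mem_filter, Finset.mem_univ, true_and] at hH ⊢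
    exact (graphOfEdges_filter_mem_edgeSet hG hH.1).symm ▸ hH.2
  · intro E hE
    simp only [Finset.mem_filter, Finset.mem_univ, true_and] at hE ⊢
    refine ⟨edgeSet_subset_edgeSet.1 ?_, hE⟩
    rw [edgeSet_graphOfEdges hG, hG]
    exact Set.image_subset_range _ _
  · exact fun H hH => graphOfEdges_filter_mem_edgeSet hG (Finset.mem_filter.1 hH).2.1
  · intro E _
    simp [edgeSet_graphOfEdges hG, ho.eq_iff]
  · intro H hH
    have hfilter := graphOfEdges_filter_mem_edgeSet hG (Finset.mem_filter.1 hH).2.1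
    rw [← Finset.prod_image ho.injOn]
    refine Finset.prod_congr (Finset.coe_injective ?_) fun _ _ => rfl
    rw [coe_edgeFinset, Finset.coe_image, ← edgeSet_graphOfEdges hG, hfilter]

end EnumeratedEdges

end GenFun

section ClassLabel

variable {α : Type*} [DecidableEq α]

/-- A labelling whose fibres are the classes of the equivalence relation generated by a list of
pairs, computed by merging the two classes of one pair after another. -/
def classLabel : List (α × α) → α → α
  | [] => id
  | (a, b) :: l => fun u =>
    if classLabel l u = classLabel l a then classLabel l b else classLabel l u

theorem ker_classLabel_le_iff {l : List (α × α)} {r : Setoid α} :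
    Setoid.ker (classLabel l) ≤ r ↔ ∀ e ∈ l, r e.1 e.2 := by
  induction l with
  | nil => simp [classLabel, Setoid.le_def, Setoid.ker_def]
  | cons e l ih =>
    obtain ⟨a, b⟩ := e
    rw [List.forall_mem_cons, ← ih]
    simp only [Setoid.le_def, Setoid.ker_def, classLabel]
    refine ⟨fun h => ⟨h (by split_ifs <;> simp_all), fun huv => h (by simp only [huv])⟩, ?_⟩
    rintro ⟨hab, hl⟩ u v huv
    split_ifs at huv with hu hv hv
    · exact hl (hu.trans hv.symm)
    · exact r.trans (hl hu) (r.trans hab (hl huv))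
    · exact r.trans (hl huv) (r.trans (r.symm hab) (hl hv.symm))
    · exact hl huv

theorem card_quotient_ker {α β : Type*} [Fintype α] [DecidableEq β] (c : α → β) :
    Nat.card (Quotient (Setoid.ker c)) = (Finset.univ.image c).card := by
  rw [Nat.card_congr (Setoid.quotientKerEquivRange c), Nat.card_coe_set_eq, ← Set.ncard_coe_finset,
    Finset.coe_image, Finset.coe_univ, Set.image_univ]

end ClassLabel

section State

/-- The partitions of three terminals: all in one block, the terminal `i` separated from the other
two, and all separated. They are the possible values of `terminalSetoid`. -/
inductive State
  | joined
  | split (i : Fin 3)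
  | separate
  deriving DecidableEq, Fintype

namespace State

/-- Pairs of terminals generating the partition. -/
def links : State → List (Fin 3 × Fin 3)
  | joined => [(0, 1), (1, 2)]
  | split i => [(i + 1, i + 2)]
  | separate => []

/-- The number of blocks of the partition. -/
def blocks : State → ℕ
  | joined => 1
  | split _ => 2
  | separate => 3

/-- A name for the block of each terminal. -/
def label (x : State) : Fin 3 → Fin 3 :=
  classLabel x.links

/-- The partition as an equivalence relation. -/
def setoid (x : State) : Setoid (Fin 3) :=
  Setoid.ker x.label

theorem ker_eq_setoid_iff {α : Type*} {c : Fin 3 → α} {x : State} :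
    Setoid.ker c = x.setoid ↔ ∀ i j, c i = c j ↔ x.label i = x.label j :=
  Setoid.ext_iff

theorem card_quotient_setoid (x : State) : Nat.card (Quotient x.setoid) = x.blocks := by
  rw [setoid, card_quotient_ker]
  revert x
  decide

theorem setoid_injective : Function.Injective setoid := by
  have h : ∀ x y : State, (∀ i j, x.label i = x.label j ↔ y.label i = y.label j) → x = y := by
    decide
  exact fun x y hxy => h x y (ker_eq_setoid_iff.1 hxy)

theorem setoid_surjective : Function.Surjective setoid := by
  classical
  intro r
  have h : ∀ b : Fin 3 → Fin 3 → Bool, (∀ i, b i i) → (∀ i j, b i j → b j i) →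
      (∀ i j k, b i j → b j k → b i k) → ∃ x : State, ∀ i j, x.label i = x.label j ↔ b i j := by
    decide +kernel
  obtain ⟨x, hx⟩ := h (fun i j => decide (r i j)) (by simp)
    (by simpa using fun i j => r.symm) (by simpa using fun i j k => r.trans)
  exact ⟨x, Setoid.ext fun i j => (hx i j).trans decide_eq_true_iff⟩

theorem setoid_joined : joined.setoid = ⊤ := by
  have h : ∀ i j, joined.label i = joined.label j := by decide
  exact Setoid.eq_top_iff.2 h

theorem setoid_separate : separate.setoid = ⊥ :=
  Setoid.ker_eq_bot_iff.2 Function.injective_id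

theorem eq_setoid_split_iff {i : Fin 3} {r : Setoid (Fin 3)} :
    r = (split i).setoid ↔ r (i + 1) (i + 2) ∧ ¬ r i (i + 1) := by
  obtain ⟨x, rfl⟩ := setoid_surjective r
  rw [setoid_injective.eq_iff]
  change x = split i ↔ x.label (i + 1) = x.label (i + 2) ∧ ¬ x.label i = x.label (i + 1)
  revert x i
  decide

end State

end State

section Triangle

/-- Three copies of a graph with three terminals `p` are placed in the corners of a triangle: the
terminal `l` of the copy `k` is identified with the terminal `k` of the copy `l`, so that the
terminal `k` of the copy `k` remains as a corner. -/
structure IsTriangleGluing {V W : Type*} (p : Fin 3 → V) (f : Fin 3 → V ↪ W) : Prop where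
  injective : Function.Injective p
  surjective : ∀ w, ∃ k v, f k v = w
  swap : ∀ k l, f k (p l) = f l (p k)
  eq_terminal : ∀ {k l}, k ≠ l → ∀ {v w}, f k v = f l w → v = p l

/-- The identifications made in a triangle gluing. -/
def midpointLinks : List ((Fin 3 × Fin 3) × (Fin 3 × Fin 3)) :=
  [((0, 1), (1, 0)), ((1, 2), (2, 1)), ((2, 0), (0, 2))]

theorem forall_mem_midpointLinks_iff {r : Setoid (Fin 3 × Fin 3)} :
    (∀ e ∈ midpointLinks, r e.1 e.2) ↔ ∀ k l, r (k, l) (l, k) := by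
  simp only [midpointLinks, List.forall_mem_cons, List.not_mem_nil, IsEmpty.forall_iff,
    implies_true, and_true]
  refine ⟨fun ⟨h01, h12, h20⟩ => ?_, fun h => ⟨h _ _, h _ _, h _ _⟩⟩
  simp [Fin.forall_fin_succ, h01, h12, h20, r.symm h01, r.symm h12, r.symm h20]

/-- Pairs of terminals generating the partition of a triangle gluing whose copies have the
states `x`. -/
def gluedLinks (x : Fin 3 → State) : List ((Fin 3 × Fin 3) × (Fin 3 × Fin 3)) :=
  midpointLinks ++
    (List.finRange 3).flatMap fun k => (x k).links.map fun e => ((k, e.1), (k, e.2))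

/-- A name for the component of each terminal of the copies in a triangle gluing. -/
def gluedLabel (x : Fin 3 → State) : Fin 3 × Fin 3 → Fin 3 × Fin 3 :=
  classLabel (gluedLinks x)

/-- The combinatorial condition for three forests of states `x` to be glued to a forest of
state `y`: every component reaches a corner, the corners are connected as prescribed by `y`, and
the numbers of edges and components are those of a forest. -/
def Yields (x : Fin 3 → State) (y : State) : Prop :=
  (∀ u, ∃ i, gluedLabel x u = gluedLabel x (i, i)) ∧
  (∀ i j, gluedLabel x (i, i) = gluedLabel x (j, j) ↔ y.label i = y.label j) ∧
  ∑ k, (x k).blocks = y.blocks + 3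

instance (x : Fin 3 → State) (y : State) : Decidable (Yields x y) :=
  inferInstanceAs (Decidable (_ ∧ _))

/-- The generating function of the forests of `G` with state `x` on the terminals `p`. -/
noncomputable def forestSum {R V : Type*} [CommSemiring R] [Fintype V] (G : SimpleGraph V)
    (w : Sym2 V → R) (p : Fin 3 → V) (x : State) : R :=
  genFun G w (IsTerminalForest p x.setoid)

namespace IsTriangleGluing

variable {V W : Type*} {p : Fin 3 → V} {f : Fin 3 → V ↪ W} (hf : IsTriangleGluing p f)
include hf

theorem isGluing : IsGluing (fun _ => p) f where
  surjective := hf.surjective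
  edgeDisjoint k l hkl := by
    rintro _ ⟨⟨v, rfl⟩, w, hv⟩ _ ⟨⟨v', rfl⟩, w', hv'⟩
    rw [hf.eq_terminal hkl hv.symm, hf.eq_terminal hkl hv'.symm]
  exists_eq_terminal {_ l} hkl _ _ h := ⟨l, hf.eq_terminal hkl h⟩

theorem ker_node_le_iff {r : Setoid (Fin 3 × Fin 3)} :
    Setoid.ker (node (fun _ => p) f) ≤ r ↔ ∀ k l, r (k, l) (l, k) := by
  refine ⟨fun h k l => h (hf.swap k l), ?_⟩
  rintro h ⟨k, i⟩ ⟨l, j⟩ (hij : f k (p i) = f l (p j))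
  obtain rfl | hkl := eq_or_ne k l
  · rw [hf.injective ((f k).injective hij)]
  · obtain rfl := hf.injective (hf.eq_terminal hkl hij)
    obtain rfl := hf.injective (hf.eq_terminal hkl.symm hij.symm)
    exact h _ _

theorem gluedSetoid_eq (x : Fin 3 → State) :
    gluedSetoid (Setoid.ker (node (fun _ => p) f)) (fun k => (x k).setoid) =
      Setoid.ker (gluedLabel x) := by
  refine eq_of_forall_ge_iff fun r => ?_
  rw [gluedSetoid_le_iff, hf.ker_node_le_iff, gluedLabel, ker_classLabel_le_iff, gluedLinks,
    List.forall_mem_append, forall_mem_midpointLinks_iff]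
  refine and_congr_right fun _ => ?_
  simp only [State.setoid, State.label, ker_classLabel_le_iff, List.forall_mem_flatMap,
    List.forall_mem_map, List.mem_finRange, forall_const, Setoid.comap_rel]

-- Each midpoint lies in two consecutive copies, and leaving out `p (k + 1)` from the copy `k` keeps
-- exactly one of its two occurrences.
theorem bijective_sigma_ne : Function.Bijective
    fun u : Σ k : Fin 3, {v : V // v ≠ p (k + 1)} => f u.1 u.2.1 := by
  constructor
  · rintro ⟨k, v, hv⟩ ⟨l, w, hw⟩ (h : f k v = f l w)
    obtain rfl | hkl := eq_or_ne k l
    · obtain rfl := (f k).injective h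
      rfl
    · obtain rfl := hf.eq_terminal hkl h
      obtain rfl := hf.eq_terminal hkl.symm h.symm
      rw [hf.injective.ne_iff] at hv hw
      omega
  · intro w
    obtain ⟨k, v, rfl⟩ := hf.surjective w
    by_cases hv : v = p (k + 1)
    · exact ⟨⟨k + 1, p k, hf.injective.ne (by omega)⟩, by rw [hv, hf.swap]⟩
    · exact ⟨⟨k, v, hv⟩, rfl⟩

theorem card_add_three [Finite V] : Nat.card W + 3 = 3 * Nat.card V := by
  have hne (a : V) : Nat.card {v // v ≠ a} + 1 = Nat.card V := by
    classical rw [← Finite.card_option, Nat.card_congr (Equiv.optionSubtypeNe a)]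
  rw [← Nat.card_congr (Equiv.ofBijective _ hf.bijective_sigma_ne), Nat.card_sigma,
    Fin.sum_univ_three, ← hne (p (0 + 1))]
  have h1 := hne (p (1 + 1))
  have h2 := hne (p (2 + 1))
  have h0 := hne (p (0 + 1))
  omega

variable [Finite V] [Finite W] {H : Fin 3 → SimpleGraph V} {y : State}

theorem isTerminalForest_glue_iff :
    IsTerminalForest (fun k => f k (p k)) y.setoid (glue f H) ↔
      ∃ x, Yields x y ∧ ∀ k, IsTerminalForest p (x k).setoid (H k) := by
  have hyields (x : Fin 3 → State) : Yields x y ↔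
      (∀ u, ∃ i, Setoid.ker (gluedLabel x) u (i, i)) ∧
      (Setoid.ker (gluedLabel x)).comap (fun i => (i, i)) = y.setoid ∧
      ∑ k, Nat.card (Quotient (x k).setoid) + Nat.card W =
        Nat.card (Quotient y.setoid) + ∑ _ : Fin 3, Nat.card V := by
    have hcard := hf.card_add_three
    simp only [State.card_quotient_setoid, Finset.sum_const, Finset.card_univ, Fintype.card_fin,
      smul_eq_mul]
    exact and_congr_right' (and_congr State.ker_eq_setoid_iff.symm (by omega))
  have hlift : Function.Surjective fun (x : Fin 3 → State) k => (x k).setoid :=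
    State.setoid_surjective.comp_left
  refine (hf.isGluing.isTerminalForest_glue_iff (out := fun k => (k, k))).trans ?_
  refine hlift.exists.trans (exists_congr fun x => ?_)
  rw [hyields, hf.gluedSetoid_eq, and_comm]

end IsTriangleGluing

theorem IsTriangleGluing.forestSum_glue {R V W : Type*} [CommSemiring R] [Fintype V] [Fintype W]
    {p : Fin 3 → V} {f : Fin 3 → V ↪ W} (hf : IsTriangleGluing p f) (G : Fin 3 → SimpleGraph V)
    (w : Sym2 W → R) (y : State) :
    forestSum (glue f G) w (fun k => f k (p k)) y =
      ∑ x with Yields x y, ∏ k, forestSum (G k) (fun e => w (e.map (f k))) p (x k) := by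
  have hedge := hf.isGluing.edgeDisjoint
  simp only [forestSum, ← hedge.genFun_glue]
  rw [← genFun_exists_mem]
  · refine genFun_congr (fun _ _ => rfl) fun K hK => ?_
    rw [← glue_comap hK, hf.isTerminalForest_glue_iff, glue_comap hK]
    simp only [Finset.mem_filter, Finset.mem_univ, true_and]
  · refine fun K x x' hx hx' => funext fun k => State.setoid_injective ?_
    rw [← (hx k).terminalSetoid_eq, (hx' k).terminalSetoid_eq]

end Triangle

section Enumeration

/-- The triple `t` placed on the copies `i`, `i + 1`, `i + 2`, in this order. -/
def placeFrom {α : Type*} (i : Fin 3) (t : Fin 3 → α) : Fin 3 → α :=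
  fun k => t (k - i)

variable {R : Type*} [CommSemiring R] (F : Fin 3 → State → R)

theorem prod_placeFrom (i : Fin 3) (t : Fin 3 → State) :
    ∏ k, F k (placeFrom i t k) = F i (t 0) * F (i + 1) (t 1) * F (i + 2) (t 2) := by
  rw [← Equiv.prod_comp (Equiv.addLeft i), Fin.prod_univ_three]
  simp [placeFrom]

theorem sum_filter_eq_sum_map {α : Type*} [Fintype α] {P : α → Prop}
    [DecidablePred P] {l : List α} (hl : l.Nodup) (h : ∀ x, P x ↔ x ∈ l) (g : α → R) :
    ∑ x with P x, g x = (l.map g).sum := by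
  classical
  rw [← List.sum_toFinset g hl]
  exact Finset.sum_congr (by ext; simp [h]) fun _ _ => rfl

theorem sum_map_flatMap_finRange {α : Type*} {n : ℕ} (l : Fin n → List α) (g : α → R) :
    (((List.finRange n).flatMap l).map g).sum = ∑ i, ((l i).map g).sum := by
  rw [List.map_flatMap, List.flatMap_def, List.sum_flatten, List.map_map, Fin.sum_univ_def]
  rfl

open State

theorem sum_yields_joined : ∑ x with Yields x joined, ∏ k, F k (x k) =
    ∑ i, (F i (split (i + 1)) + F i (split (i + 2))) * F (i + 1) joined * F (i + 2) joined := by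
  rw [sum_filter_eq_sum_map (l := (List.finRange 3).flatMap fun i =>
    [placeFrom i ![split (i + 1), joined, joined], placeFrom i ![split (i + 2), joined, joined]])
    (by decide +kernel) (by decide +kernel)]
  rw [sum_map_flatMap_finRange]
  refine Finset.sum_congr rfl fun i _ => ?_
  simp only [List.map_cons, List.map_nil, List.sum_cons, List.sum_nil, prod_placeFrom,
    Matrix.cons_val]
  ring

theorem sum_yields_split (i : Fin 3) :
    ∑ x with Yields x (split i), ∏ k, F k (x k) =
      F i joined * F (i + 1) (split i) * F (i + 2) (split i) +
      F i (split i) * F (i + 1) joined * (F (i + 2) (split i) + F (i + 2) (split (i + 1))) +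
      F i (split i) * (F (i + 1) (split i) + F (i + 1) (split (i + 2))) * F (i + 2) joined +
      F i (split (i + 1)) * F (i + 1) joined * F (i + 2) (split i) +
      F i (split (i + 2)) * F (i + 1) (split i) * F (i + 2) joined +
      F i separate * F (i + 1) joined * F (i + 2) joined := by
  rw [sum_filter_eq_sum_map (l :=
    [![joined, split i, split i], ![split i, joined, split i],
      ![split i, joined, split (i + 1)], ![split i, split i, joined],
      ![split i, split (i + 2), joined], ![split (i + 1), joined, split i],
      ![split (i + 2), split i, joined], ![separate, joined, joined]].map (placeFrom i))
    (by revert i; decide +kernel) (by revert i; decide +kernel)]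
  simp only [List.map_cons, List.map_nil, List.sum_cons, List.sum_nil, prod_placeFrom,
    Matrix.cons_val]
  ring

theorem sum_yields_separate : ∑ x with Yields x separate, ∏ k, F k (x k) =
    ∑ i, (F i separate *
        (F (i + 1) joined * (F (i + 2) (split (i + 1)) + F (i + 2) (split (i + 2))) +
          (F (i + 1) (split (i + 1)) + F (i + 1) (split (i + 2))) * F (i + 2) joined) +
      F i (split i) * (F (i + 1) (split i) * F (i + 2) (split (i + 1)) +
        F (i + 1) (split (i + 2)) * F (i + 2) (split i) +
        F (i + 1) (split (i + 1)) * (F (i + 2) (split i) + F (i + 2) (split (i + 1))))) +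
    ∏ i, F i (split (i + 1)) + ∏ i, F i (split (i + 2)) := by
  rw [sum_filter_eq_sum_map (l := ((List.finRange 3).flatMap fun i =>
    [![separate, joined, split (i + 1)], ![separate, joined, split (i + 2)],
      ![separate, split (i + 1), joined], ![separate, split (i + 2), joined],
      ![split i, split i, split (i + 1)], ![split i, split (i + 2), split i],
      ![split i, split (i + 1), split i], ![split i, split (i + 1), split (i + 1)]].map
        (placeFrom i)) ++ [fun i => split (i + 1), fun i => split (i + 2)])
    (by decide +kernel) (by decide +kernel)]
  rw [List.map_append, List.sum_append, sum_map_flatMap_finRange, add_assoc]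
  congr 1
  · refine Finset.sum_congr rfl fun i _ => ?_
    simp only [List.map_cons, List.map_nil, List.sum_cons, List.sum_nil, prod_placeFrom,
      Matrix.cons_val]
    ring
  · simp only [List.map_cons, List.map_nil, List.sum_cons, List.sum_nil, add_zero]

end Enumeration

section BaseTriangle

/-- The edge of a triangle opposite to the vertex `m`. -/
def oppositeEdge (m : Fin 3) : Sym2 (Fin 3) :=
  s(m + 1, m + 2)

theorem oppositeEdge_injective : Function.Injective oppositeEdge := by
  decide

theorem edgeSet_top_eq_range_oppositeEdge :
    (⊤ : SimpleGraph (Fin 3)).edgeSet = Set.range oppositeEdge := by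
  have h : ∀ i j : Fin 3, i ≠ j ↔ ∃ m, oppositeEdge m = s(i, j) := by decide
  ext ⟨i, j⟩
  exact h i j

/-- A name for the component of each vertex in the spanning subgraph of a triangle with the
edges `E`. -/
def triangleLabel (E : Finset (Fin 3)) : Fin 3 → Fin 3 :=
  classLabel (((List.finRange 3).filter (· ∈ E)).map fun m => (m + 1, m + 2))

theorem reachableSetoid_graphOfEdges_oppositeEdge (E : Finset (Fin 3)) :
    (graphOfEdges oppositeEdge E).reachableSetoid = Setoid.ker (triangleLabel E) := by
  refine eq_of_forall_ge_iff fun r => ?_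
  rw [reachableSetoid_le_iff, triangleLabel, ker_classLabel_le_iff]
  simp only [← mem_edgeSet, edgeSet_graphOfEdges edgeSet_top_eq_range_oppositeEdge]
  simp only [List.forall_mem_map, List.mem_filter, List.mem_finRange, true_and, decide_eq_true_eq]
  refine ⟨fun h m hm => h _ _ ⟨m, hm, rfl⟩, ?_⟩
  rintro h u v ⟨m, hm, huv⟩
  obtain ⟨rfl, rfl⟩ | ⟨rfl, rfl⟩ := Sym2.eq_iff.1 huv
  · exact h m hm
  · exact r.symm (h m hm)

/-- The edges `E` form a spanning forest of a triangle which partitions the vertices according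
to `x`. -/
def IsTriangleForest (E : Finset (Fin 3)) (x : State) : Prop :=
  (∀ i j, triangleLabel E i = triangleLabel E j ↔ x.label i = x.label j) ∧ E.card + x.blocks = 3

instance (E : Finset (Fin 3)) (x : State) : Decidable (IsTriangleForest E x) :=
  inferInstanceAs (Decidable (_ ∧ _))

theorem isTerminalForest_graphOfEdges_oppositeEdge {E : Finset (Fin 3)} {x : State} :
    IsTerminalForest id x.setoid (graphOfEdges oppositeEdge E) ↔ IsTriangleForest E x := by
  have hedges : Nat.card (graphOfEdges oppositeEdge E).edgeSet = E.card := by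
    rw [edgeSet_graphOfEdges edgeSet_top_eq_range_oppositeEdge,
      Nat.card_image_of_injective oppositeEdge_injective]
    simp
  have hcov : Covers id (graphOfEdges oppositeEdge E) := fun v => ⟨v, Reachable.refl v⟩
  have hterminal : terminalSetoid id (graphOfEdges oppositeEdge E) =
      Setoid.ker (triangleLabel E) := reachableSetoid_graphOfEdges_oppositeEdge E
  rw [IsTriangleForest, ← State.ker_eq_setoid_iff, ← hterminal, ← hedges,
    ← State.card_quotient_setoid]
  constructor
  · exact fun h => ⟨h.terminalSetoid_eq, h.card_edgeSet_add.trans (Nat.card_fin 3)⟩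
  · rintro ⟨hx, hcard⟩
    exact ⟨hcov.isAcyclic_iff.2 (by rwa [hx, Nat.card_fin]), hcov, hx⟩

variable {R : Type*} [CommSemiring R] (w : Sym2 (Fin 3) → R)

theorem forestSum_triangle (x : State) : forestSum ⊤ w id x =
    ∑ E with IsTriangleForest E x, ∏ m ∈ E, w (oppositeEdge m) := by
  classical
  rw [forestSum, genFun_eq_sum_graphOfEdges oppositeEdge_injective
    edgeSet_top_eq_range_oppositeEdge]
  simp only [isTerminalForest_graphOfEdges_oppositeEdge]

theorem forestSum_triangle_joined : forestSum ⊤ w id .joined =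
    ∑ m, w (oppositeEdge (m + 1)) * w (oppositeEdge (m + 2)) := by
  have h : (Finset.univ.filter fun E => IsTriangleForest E .joined) =
      Finset.univ.image fun m : Fin 3 => {m + 1, m + 2} := by
    decide +kernel
  rw [forestSum_triangle, h, Finset.sum_image (by decide)]
  exact Finset.sum_congr rfl fun m _ => Finset.prod_pair (by omega)

theorem forestSum_triangle_split (i : Fin 3) :
    forestSum ⊤ w id (.split i) = w (oppositeEdge i) := by
  have h : (Finset.univ.filter fun E => IsTriangleForest E (.split i)) = {{i}} := by
    revert i
    decide +kernel
  rw [forestSum_triangle, h, Finset.sum_singleton, Finset.prod_singleton]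

theorem forestSum_triangle_separate : forestSum ⊤ w id .separate = 1 := by
  have h : (Finset.univ.filter fun E => IsTriangleForest E .separate) = {∅} := by
    decide +kernel
  rw [forestSum_triangle, h, Finset.sum_singleton, Finset.prod_empty]

end BaseTriangle

section Copies

theorem shift_injective (d : ℕ × ℕ) : Function.Injective (shift d) := by
  intro v w h
  simp only [shift, Prod.ext_iff] at h
  exact Prod.ext (by omega) (by omega)

theorem shift_zero : shift (0, 0) = id := by
  funext v
  simp [shift]

theorem mem_vertices_succ {n : ℕ} {w : ℕ × ℕ} :
    w ∈ vertices (n + 1) ↔ ∃ k, ∃ v ∈ vertices n, shift (cornerPoint n k) v = w := by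
  simp only [vertices, Finset.mem_union, Finset.mem_image, Fin.exists_fin_succ, cornerPoint,
    shift_zero, id, exists_eq_right, Fin.succ_zero_eq_one, Fin.succ_one_eq_two,
    IsEmpty.exists_iff, or_false, or_assoc]

theorem add_le_of_mem_vertices {n : ℕ} {v : ℕ × ℕ} (hv : v ∈ vertices n) : v.1 + v.2 ≤ 2 ^ n := by
  induction n generalizing v with
  | zero => revert v; decide
  | succ n ih =>
    obtain ⟨k, w, hw, rfl⟩ := mem_vertices_succ.1 hv
    have hw := ih hw
    fin_cases k <;> dsimp only [cornerPoint, shift] <;> omega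

/-- The inclusion of the `k`-th of the three copies of the `n`-th graph in the next one. -/
def copy (n : ℕ) (k : Fin 3) : Vert n ↪ Vert (n + 1) where
  toFun v := ⟨shift (cornerPoint n k) v.1, mem_vertices_succ.2 ⟨k, v.1, v.2, rfl⟩⟩
  inj' _ _ h := Subtype.ext (shift_injective _ (congrArg Subtype.val h))

theorem corner_succ (n : ℕ) : corner (n + 1) = fun k => copy n k (corner n k) := by
  funext k
  refine Subtype.ext ?_
  fin_cases k <;> simp [corner, copy, cornerPoint, shift, pow_succ, mul_two]

theorem isTriangleGluing_copy (n : ℕ) : IsTriangleGluing (corner n) (copy n) where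
  injective i j h := by
    have hpos := Nat.two_pow_pos n
    replace h : cornerPoint n i = cornerPoint n j := congrArg Subtype.val h
    rw [Prod.ext_iff] at h
    fin_cases i <;> fin_cases j <;> first | rfl | (dsimp only [cornerPoint] at h; omega)
  surjective w := by
    obtain ⟨k, v, hv, h⟩ := mem_vertices_succ.1 w.2
    exact ⟨k, ⟨v, hv⟩, Subtype.ext h⟩
  swap k l := Subtype.ext (Prod.ext (add_comm _ _) (add_comm _ _))
  eq_terminal {k l} hkl v w h := by
    have hv := add_le_of_mem_vertices v.2
    have hw := add_le_of_mem_vertices w.2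
    replace h : shift (cornerPoint n k) v.1 = shift (cornerPoint n l) w.1 := congrArg Subtype.val h
    suffices v.1 = cornerPoint n l from Subtype.ext this
    rw [Prod.ext_iff] at h ⊢
    fin_cases k <;> fin_cases l <;>
      first
      | exact absurd rfl hkl
      | dsimp only [shift, cornerPoint] at h ⊢
        omega

theorem mem_edges_succ {n : ℕ} {x : Label} {u v : ℕ × ℕ} :
    s(u, v) ∈ edges x (n + 2) ↔ ∃ k p q, s(p, q) ∈ edges x (n + 1) ∧
      shift (cornerPoint (n + 1) k) p = u ∧ shift (cornerPoint (n + 1) k) q = v := by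
  have hcopy : s(u, v) ∈ edges x (n + 2) ↔
      ∃ k, ∃ e ∈ edges x (n + 1), e.map (shift (cornerPoint (n + 1) k)) = s(u, v) := by
    simp only [edges, Finset.mem_union, Finset.mem_image, Fin.exists_fin_succ, cornerPoint,
      shift_zero, Sym2.map_id', id, exists_eq_right, Fin.succ_zero_eq_one, Fin.succ_one_eq_two,
      IsEmpty.exists_iff, or_false, or_assoc]
  refine hcopy.trans (exists_congr fun k => ⟨?_, fun ⟨p, q, h, hp, hq⟩ => ⟨_, h, by simp [hp, hq]⟩⟩)
  rintro ⟨⟨p, q⟩, h, heq⟩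
  obtain ⟨hp, hq⟩ | ⟨hp, hq⟩ := Sym2.eq_iff.1 heq
  · exact ⟨p, q, h, hp, hq⟩
  · exact ⟨q, p, Sym2.eq_swap ▸ h, hq, hp⟩

theorem mem_vertices_of_mem_edges {n : ℕ} {x : Label} {u v : ℕ × ℕ}
    (h : s(u, v) ∈ edges x (n + 1)) : u ∈ vertices (n + 1) ∧ v ∈ vertices (n + 1) := by
  induction n generalizing u v with
  | zero =>
    have hbase : ∀ e ∈ edges x 1, e ∈ (vertices 1).sym2 := by
      cases x <;> decide +kernel
    exact Finset.mk_mem_sym2_iff.1 (hbase _ h)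
  | succ n ih =>
    obtain ⟨k, p, q, hpq, rfl, rfl⟩ := mem_edges_succ.1 h
    obtain ⟨hp, hq⟩ := ih hpq
    exact ⟨mem_vertices_succ.2 ⟨k, p, hp, rfl⟩, mem_vertices_succ.2 ⟨k, q, hq, rfl⟩⟩

/-- The graph formed by the edges of the `n`-th graph carrying the label `x`. -/
def labelGraph (x : Label) (n : ℕ) : SimpleGraph (Vert n) :=
  fromEdgeSet {e | e.map Subtype.val ∈ edges x n}

theorem labelGraph_adj {x : Label} {n : ℕ} {u v : Vert n} :
    (labelGraph x n).Adj u v ↔ s(u.1, v.1) ∈ edges x n ∧ u ≠ v :=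
  fromEdgeSet_adj _

theorem graph_adj {n : ℕ} {u v : Vert n} :
    (graph n).Adj u v ↔ ∃ x, (labelGraph x n).Adj u v := by
  simp only [labelGraph_adj, exists_and_right]
  exact fromEdgeSet_adj _

theorem labelGraph_succ (x : Label) (n : ℕ) :
    labelGraph x (n + 2) = glue (copy (n + 1)) fun _ => labelGraph x (n + 1) := by
  ext u v
  rw [labelGraph_adj, glue_adj, mem_edges_succ]
  constructor
  · rintro ⟨⟨k, p, q, hpq, hu, hv⟩, huv⟩
    obtain ⟨hp, hq⟩ := mem_vertices_of_mem_edges hpq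
    refine ⟨k, ⟨p, hp⟩, ⟨q, hq⟩, labelGraph_adj.2 ⟨hpq, ?_⟩, Subtype.ext hu, Subtype.ext hv⟩
    rintro ⟨⟩
    exact huv (Subtype.ext (hu.symm.trans hv))
  · rintro ⟨k, p, q, hpq, rfl, rfl⟩
    exact ⟨⟨k, p, q, (labelGraph_adj.1 hpq).1, rfl, rfl⟩, (copy _ k).injective.ne hpq.ne⟩

theorem graph_succ (n : ℕ) : graph (n + 2) = glue (copy (n + 1)) fun _ => graph (n + 1) := by
  ext u v
  simp only [graph_adj, labelGraph_succ, glue_adj]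
  tauto

theorem labelGraph_adj_copy {x : Label} {n : ℕ} {k : Fin 3} {u v : Vert (n + 1)} :
    (labelGraph x (n + 2)).Adj (copy (n + 1) k u) (copy (n + 1) k v) ↔
      (labelGraph x (n + 1)).Adj u v := by
  rw [labelGraph_succ, ← comap_adj, (isTriangleGluing_copy _).isGluing.edgeDisjoint.comap_glue]

theorem edgeWeight_copy {R : Type*} (a b c : R) {n : ℕ} (k : Fin 3) {e : Sym2 (Vert (n + 1))}
    (he : e ∈ (graph (n + 1)).edgeSet) :
    edgeWeight a b c (n + 2) (e.map (copy (n + 1) k)) = edgeWeight a b c (n + 1) e := by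
  induction e with | _ u v =>
  have hne : u ≠ v := Adj.ne ((mem_edgeSet _).1 he)
  have hlabel (x : Label) : s((copy (n + 1) k u).1, (copy (n + 1) k v).1) ∈ edges x (n + 2) ↔
      s(u.1, v.1) ∈ edges x (n + 1) := by
    simpa only [labelGraph_adj, ne_eq, (copy _ k).injective.eq_iff, hne, not_false_eq_true,
      and_true] using labelGraph_adj_copy (x := x) (k := k) (u := u) (v := v)
  exact if_congr (hlabel _) rfl (if_congr (hlabel _) rfl rfl)

end Copies

section StateSum

theorem isTerminalForest_setoid_iff {V : Type*} [Finite V] {p : Fin 3 → V} {x : State}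
    {H : SimpleGraph V} : IsTerminalForest p x.setoid H ↔
      IsForestWith x.blocks H ∧ terminalSetoid p H = x.setoid := by
  rw [isTerminalForest_iff, State.card_quotient_setoid]

variable {R : Type*} [CommSemiring R] (a b c : R)

/-- The generating function of the spanning forests of the `n`-th graph with state `x` on the
outmost vertices. -/
noncomputable def stateSum (n : ℕ) (x : State) : R :=
  forestSum (graph n) (edgeWeight a b c n) (corner n) x

theorem T_eq_stateSum (n : ℕ) : T a b c n = stateSum a b c n .joined := by
  refine genFun_congr (fun _ _ => rfl) fun H _ => ?_
  rw [State.setoid_joined, isTerminalForest_top_iff]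

theorem S_eq_stateSum (i : Fin 3) (n : ℕ) : S a b c i n = stateSum a b c n (.split i) := by
  refine genFun_congr (fun _ _ => rfl) fun H _ => ?_
  rw [isTerminalForest_setoid_iff, State.eq_setoid_split_iff]
  rfl

theorem Q_eq_stateSum (n : ℕ) : Q a b c n = stateSum a b c n .separate := by
  refine genFun_congr (fun _ _ => rfl) fun H _ => ?_
  rw [isTerminalForest_setoid_iff, State.setoid_separate, eq_bot_iff]
  refine and_congr_right' (forall₂_congr fun i j => ?_)
  exact not_imp_not

theorem stateSum_succ (n : ℕ) (y : State) : stateSum a b c (n + 2) y =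
    ∑ x with Yields x y, ∏ k, stateSum a b c (n + 1) (x k) := by
  rw [stateSum, graph_succ, corner_succ, (isTriangleGluing_copy (n + 1)).forestSum_glue]
  refine Finset.sum_congr rfl fun x _ => Finset.prod_congr rfl fun k _ => ?_
  exact genFun_congr (fun e he => edgeWeight_copy a b c k he) fun _ _ => Iff.rfl

end StateSum

section FirstGraph

theorem IsTriangleGluing.of_bijective {V W : Type*} {p : Fin 3 → V} {f : Fin 3 → V ↪ W}
    (hf : IsTriangleGluing p f) (hp : Function.Bijective p) :
    IsTriangleGluing id fun k => (⟨p, hf.injective⟩ : Fin 3 ↪ V).trans (f k) where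
  injective := Function.injective_id
  surjective w := by
    obtain ⟨k, v, rfl⟩ := hf.surjective w
    obtain ⟨i, rfl⟩ := hp.2 v
    exact ⟨k, i, rfl⟩
  swap := hf.swap
  eq_terminal hkl _ _ h := hp.1 (hf.eq_terminal hkl h)

theorem corner_zero_bijective : Function.Bijective (corner 0) := by
  decide +kernel

/-- The inclusion of the `k`-th of the three corner triangles of the first graph. -/
def baseCopy (k : Fin 3) : Fin 3 ↪ Vert 1 :=
  (⟨corner 0, corner_zero_bijective.1⟩ : Fin 3 ↪ Vert 0).trans (copy 0 k)

theorem isTriangleGluing_baseCopy : IsTriangleGluing id baseCopy :=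
  (isTriangleGluing_copy 0).of_bijective corner_zero_bijective

theorem exists_label {P : Label → Prop} : (∃ x, P x) ↔ P .a ∨ P .b ∨ P .c :=
  ⟨fun ⟨x, hx⟩ => by cases x <;> simp [hx],
    fun h => by rcases h with h | h | h <;> exact ⟨_, h⟩⟩

theorem graph_one : graph 1 = glue baseCopy fun _ => ⊤ := by
  ext u v
  rw [graph_adj, exists_label, glue_adj]
  simp only [labelGraph_adj, top_adj]
  revert u v
  decide +kernel

theorem edgeWeight_baseCopy {R : Type*} (a b c : R) (k m : Fin 3) :
    edgeWeight a b c 1 ((oppositeEdge m).map (baseCopy k)) =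
      if m = k + 2 then a else if m = k + 1 then b else c := by
  have ha : ∀ k m : Fin 3, ((oppositeEdge m).map (baseCopy k)).map Subtype.val ∈ edges .a 1 ↔
      m = k + 2 := by decide +kernel
  have hb : ∀ k m : Fin 3, ((oppositeEdge m).map (baseCopy k)).map Subtype.val ∈ edges .b 1 ↔
      m = k + 1 := by decide +kernel
  simp only [edgeWeight, ha, hb]

variable {R : Type*} [CommSemiring R] (a b c : R)

/-- The generating function of the spanning forests of the `k`-th corner triangle of the first
graph with state `x`. -/
noncomputable def baseSum (k : Fin 3) (x : State) : R :=
  forestSum ⊤ (fun e => edgeWeight a b c 1 (e.map (baseCopy k))) id x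

theorem stateSum_one (y : State) : stateSum a b c 1 y =
    ∑ x with Yields x y, ∏ k, baseSum a b c k (x k) := by
  have hcorner : corner 1 = fun k => baseCopy k (id k) := corner_succ 0
  rw [stateSum, graph_one, hcorner]
  exact isTriangleGluing_baseCopy.forestSum_glue _ _ y

theorem baseSum_joined (k : Fin 3) : baseSum a b c k .joined = a * b + a * c + b * c := by
  rw [baseSum, forestSum_triangle_joined]
  simp only [edgeWeight_baseCopy, Fin.sum_univ_three]
  fin_cases k <;>
    simp only [Fin.zero_eta, Fin.mk_one, Fin.reduceFinMk, Fin.isValue, Fin.reduceAdd, Fin.reduceEq,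
      ↓reduceIte] <;> ring

theorem baseSum_split (k i : Fin 3) : baseSum a b c k (.split i) =
    if i = k + 2 then a else if i = k + 1 then b else c := by
  rw [baseSum, forestSum_triangle_split, edgeWeight_baseCopy]

theorem baseSum_separate (k : Fin 3) : baseSum a b c k .separate = 1 :=
  forestSum_triangle_separate _

theorem stateSum_one_joined : stateSum a b c 1 .joined =
    3 * (a + b) * (a * b + a * c + b * c) ^ 2 := by
  rw [stateSum_one, sum_yields_joined]
  simp only [baseSum_joined, baseSum_split, Fin.sum_univ_three, Fin.isValue, Fin.reduceAdd,
    Fin.reduceEq, ↓reduceIte]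
  ring

theorem stateSum_one_split (i : Fin 3) : stateSum a b c 1 (.split i) =
    (a + b) * (a + b + 3 * c) * (a * b + a * c + b * c) := by
  rw [stateSum_one, sum_yields_split]
  simp only [baseSum_joined, baseSum_split, baseSum_separate]
  fin_cases i <;>
    simp only [Fin.zero_eta, Fin.mk_one, Fin.reduceFinMk, Fin.isValue, Fin.reduceAdd, Fin.reduceEq,
      ↓reduceIte] <;> ring

theorem stateSum_one_separate : stateSum a b c 1 .separate =
    (a + b) * (a + b + 3 * c) ^ 2 := by
  rw [stateSum_one, sum_yields_separate]
  simp only [baseSum_joined, baseSum_split, baseSum_separate, Fin.sum_univ_three,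
    Fin.prod_univ_three, Fin.isValue, Fin.reduceAdd, Fin.reduceEq, ↓reduceIte]
  ring

end FirstGraph

section Recursion

variable {R : Type*} [CommSemiring R] {a b c : R} {n : ℕ} {s : R}

theorem stateSum_succ_joined (hs : ∀ i, stateSum a b c (n + 1) (.split i) = s) :
    stateSum a b c (n + 2) .joined = 6 * stateSum a b c (n + 1) .joined ^ 2 * s := by
  rw [stateSum_succ, sum_yields_joined fun _ => stateSum a b c (n + 1)]
  simp only [hs, Fin.sum_univ_three]
  ring

theorem stateSum_succ_split (hs : ∀ i, stateSum a b c (n + 1) (.split i) = s) (i : Fin 3) :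
    stateSum a b c (n + 2) (.split i) = 7 * stateSum a b c (n + 1) .joined * s ^ 2 +
      stateSum a b c (n + 1) .joined ^ 2 * stateSum a b c (n + 1) .separate := by
  rw [stateSum_succ, sum_yields_split fun _ => stateSum a b c (n + 1)]
  simp only [hs]
  ring

theorem stateSum_succ_separate (hs : ∀ i, stateSum a b c (n + 1) (.split i) = s) :
    stateSum a b c (n + 2) .separate =
      12 * stateSum a b c (n + 1) .joined * s * stateSum a b c (n + 1) .separate + 14 * s ^ 3 := by
  rw [stateSum_succ, sum_yields_separate fun _ => stateSum a b c (n + 1)]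
  simp only [hs, Fin.sum_univ_three, Fin.prod_univ_three]
  ring

theorem stateSum_split_eq (n : ℕ) (i j : Fin 3) :
    stateSum a b c (n + 1) (.split i) = stateSum a b c (n + 1) (.split j) := by
  induction n generalizing i j with
  | zero => rw [stateSum_one_split, stateSum_one_split]
  | succ n ih => rw [stateSum_succ_split fun k => ih k i, stateSum_succ_split fun k => ih k i]

end Recursion

end SierpinskiTrees

theorem mainTheorem8 {R : Type*} [CommSemiring R] (a b c : R) :
    (∀ n : ℕ, 1 ≤ n → ∀ i j : Fin 3,
      SierpinskiTrees.S a b c i n = SierpinskiTrees.S a b c j n) ∧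
    (∀ n : ℕ, 1 ≤ n → ∀ i : Fin 3,
      SierpinskiTrees.T a b c (n + 1) =
        6 * SierpinskiTrees.T a b c n ^ 2 * SierpinskiTrees.S a b c i n ∧
      SierpinskiTrees.S a b c i (n + 1) =
        7 * SierpinskiTrees.T a b c n * SierpinskiTrees.S a b c i n ^ 2 +
          SierpinskiTrees.T a b c n ^ 2 * SierpinskiTrees.Q a b c n ∧
      SierpinskiTrees.Q a b c (n + 1) =
        12 * SierpinskiTrees.T a b c n * SierpinskiTrees.S a b c i n * SierpinskiTrees.Q a b c n +
          14 * SierpinskiTrees.S a b c i n ^ 3) ∧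
    SierpinskiTrees.T a b c 1 = 3 * (a + b) * (a * b + a * c + b * c) ^ 2 ∧
    (∀ i : Fin 3, SierpinskiTrees.S a b c i 1 =
      (a + b) * (a + b + 3 * c) * (a * b + a * c + b * c)) ∧
    SierpinskiTrees.Q a b c 1 = (a + b) * (a + b + 3 * c) ^ 2 := by
  simp only [SierpinskiTrees.T_eq_stateSum, SierpinskiTrees.S_eq_stateSum,
    SierpinskiTrees.Q_eq_stateSum]
  refine ⟨?_, ?_, SierpinskiTrees.stateSum_one_joined a b c,
    SierpinskiTrees.stateSum_one_split a b c, SierpinskiTrees.stateSum_one_separate a b c⟩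
  · rintro (_ | n) hn i j
    · contradiction
    · exact SierpinskiTrees.stateSum_split_eq n i j
  · rintro (_ | n) hn i
    · contradiction
    · have hsplit (k : Fin 3) := SierpinskiTrees.stateSum_split_eq (a := a) (b := b) (c := c) n k i
      exact ⟨SierpinskiTrees.stateSum_succ_joined hsplit,
        SierpinskiTrees.stateSum_succ_split hsplit i,
        SierpinskiTrees.stateSum_succ_separate hsplit⟩
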